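/- Let $k\ge 2$ and $\Sigma_k=\{0<1<\dots<k-1\}$. A \emph{necklace} over $\Sigma_k$ is a conjugacy class of words over $\Sigma_k$, i.e. a word up to rotation. The \emph{Burrows--Wheeler transform} $\mathrm{BWT}(u)$ of a necklace $u$ of length $m$ is the last column of the matrix whose rows are the $m$ shifts of $u$ (counted with multiplicity) in ascending lexicographic order. It is \emph{completely unclustered} if it consists of exactly $m$ runs, i.e. no two consecutive letters of $\mathrm{BWT}(u)$ are equal. A \emph{generalized de Bruijn word} of length $kn$ over $\Sigma_k$ is a necklace of length $kn$ whose BWT is a concatenation of one or more words each of which contains every letter of $\Sigma_k$ exactly once. A \emph{(standard) de Bruijn word} of order $d$ over $\Sigma_k$ is a necklace over $\Sigma_k$ in which every word of length $d$ over $\Sigma_k$ occurs exactly once as a circular factor; it has length $k^d$. \textbf{Theorem.} For every integer $n>0$ and every $k\ge 3$, there exists a generalized de Bruijn word of length $kn$ over $\Sigma_k$ with completely unclustered BWT. In particular, there exists a (standard) de Bruijn word of order $n$, hence of length $k^n$, over $\Sigma_k$ with completely unclustered BWT. -/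

import Mathlib

/-- A necklace over `Σ_k = {0 < 1 < ... < k-1}`: a conjugacy class of words, that is, a word up to
rotation. It need not be aperiodic. -/
abbrev Necklace (k : ℕ) : Type := Cycle (Fin k)

/-- A word containing each letter of `Σ_k` exactly once. -/
def IsAlphabetPermutation {k : ℕ} (w : List (Fin k)) : Prop :=
  ∀ a : Fin k, w.count a = 1

/-- A concatenation of one or more (possibly different) alphabet-permutations. -/
def IsAlphabetPermutationPower {k : ℕ} (w : List (Fin k)) : Prop :=
  ∃ blocks : List (List (Fin k)),
    blocks ≠ [] ∧ (∀ b ∈ blocks, IsAlphabetPermutation b) ∧ w = blocks.flatten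

/-- The maximal blocks of consecutive equal letters of a word, from left to right. -/
def wordRuns {k : ℕ} (w : List (Fin k)) : List (List (Fin k)) :=
  w.splitBy (fun a b => a == b)

namespace Necklace

/-- The rows of the Burrows-Wheeler matrix: the `|u|` shifts of `u` (counted with multiplicity if
`u` is not aperiodic) in ascending lexicographic order. -/
def bwtMatrix {k : ℕ} (u : Necklace k) : List (List (Fin k)) :=
  (Cycle.lists u).sort (fun v w => v ≤ w)

/-- The Burrows-Wheeler transform: the last column of the Burrows-Wheeler matrix. -/
def bwt {k : ℕ} (u : Necklace k) : List (Fin k) :=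
  (bwtMatrix u).filterMap List.getLast?

/-- The number `ρ(u)` of runs of the Burrows-Wheeler transform. -/
def rho {k : ℕ} (u : Necklace k) : ℕ :=
  (wordRuns (bwt u)).length

/-- The Burrows-Wheeler transform of `u` is completely unclustered: it has `|u|` runs. -/
def CompletelyUnclustered {k : ℕ} (u : Necklace k) : Prop :=
  rho u = Cycle.length u

/-- `u` is a generalized de Bruijn word of length `k * n` over `Σ_k`. -/
def IsGeneralizedDeBruijn {k : ℕ} (n : ℕ) (u : Necklace k) : Prop :=
  Cycle.length u = k * n ∧ IsAlphabetPermutationPower (bwt u)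

/-- The number of occurrences of `v` as a circular factor of `u`: the number of shifts of `u`
(counted with multiplicity) that begin with `v`. -/
def circularOccurrences {k : ℕ} (u : Necklace k) (v : List (Fin k)) : ℕ :=
  (Cycle.lists u).countP (fun w => v <+: w)

/-- `u` is a (standard) de Bruijn word of order `d` over `Σ_k`: every word of length `d` occurs
exactly once in it as a circular factor. -/
def IsDeBruijn {k : ℕ} (d : ℕ) (u : Necklace k) : Prop :=
  ∀ v : List (Fin k), v.length = d → circularOccurrences u v = 1

end Necklace

/-! A BWT made of `n` alphabet-permutations is encoded by its last-to-first map `p` on `Fin (k *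
n)`, where position `y` carries the letter `y / n`. The condition `IsBlockShuffle` makes the rows
read along `p⁻¹` increase with their starting position. So if `p` is one cycle, its necklace has BWT
`(p y) / n`.

A cyclic `p` without equal neighbours is built block by block. Composing with a permutation of one
block can put that block into a single cycle without splitting existing ones (`exists_merge`). As `k
≥ 3`, a cyclic order or its inverse avoids the letter that ends the previous block. Once each block
lies in one cycle, `m` and `m / k` share a cycle, so every position is linked to `0`. -/

/-! ### Merging cycles of a permutation -/

open Equiv Equiv.Perm in
/-- The first-return map of a permutation to a finite set: a permutation of that set sending each
point to the first positive iterate that lies in the set. -/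
theorem exists_firstReturn {X : Type*} [Finite X] [DecidableEq X] (f : Perm X) (B : Finset X) :
    ∃ r : Perm X, (∀ x ∉ B, r x = x) ∧ ∀ x ∈ B, r x ∈ B ∧
      ∃ m : ℕ, r x = (f ^ (m + 1)) x ∧ ∀ j < m, (f ^ (j + 1)) x ∉ B := by
  classical
  have hex : ∀ x : B, ∃ m : ℕ, (f ^ (m + 1)) x.1 ∈ B := fun x =>
    ⟨orderOf f - 1, by
      rw [Nat.sub_add_cancel (orderOf_pos f), pow_orderOf_eq_one]; exact x.2⟩
  let g : B → B := fun x => ⟨(f ^ (Nat.find (hex x) + 1)) x.1, Nat.find_spec (hex x)⟩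
  have key : ∀ x y : B, g x = g y → Nat.find (hex x) ≤ Nat.find (hex y) → x = y := by
    intro x y hxy hle
    have h : (f ^ (Nat.find (hex x) + 1)) x.1 = (f ^ (Nat.find (hex y) + 1)) y.1 :=
      congrArg Subtype.val hxy
    obtain ⟨d, hd⟩ := Nat.exists_eq_add_of_le hle
    have h' : x.1 = (f ^ d) y.1 := by
      rw [hd, show Nat.find (hex x) + d + 1 = (Nat.find (hex x) + 1) + d by omega,
        pow_add f (Nat.find (hex x) + 1) d, Perm.mul_apply] at h
      exact (f ^ (Nat.find (hex x) + 1)).injective h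
    rcases d with _ | d
    · exact Subtype.ext (by simpa using h')
    · exact absurd (h' ▸ x.2) (Nat.find_min (hex y) (by omega))
  have hinj : Function.Injective g := fun x y hxy =>
    (le_total (Nat.find (hex x)) (Nat.find (hex y))).elim (key x y hxy)
      fun h => (key y x hxy.symm h).symm
  let e : Perm B := Equiv.ofBijective g (Finite.injective_iff_bijective.1 hinj)
  refine ⟨Perm.ofSubtype e, fun x hx => Perm.ofSubtype_apply_of_not_mem e hx, fun x hx => ?_⟩
  have he : Perm.ofSubtype e x = (g ⟨x, hx⟩).1 := Perm.ofSubtype_apply_of_mem e hx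
  exact ⟨he ▸ (g ⟨x, hx⟩).2, Nat.find (hex ⟨x, hx⟩), he,
    fun j hj => Nat.find_min (hex ⟨x, hx⟩) hj⟩

open Equiv Equiv.Perm in
/-- Permuting the inputs of `f` inside `B` can merge all the cycles that meet `B`, even if one
value is forbidden at one point. -/
theorem exists_merge {X : Type*} [Fintype X] [DecidableEq X] (f : Perm X) (B : Finset X)
    (hB : 3 ≤ B.card) (x₀ q : X) (hx₀ : x₀ ∈ B) :
    ∃ s : Perm X, (∀ x ∉ B, s x = x) ∧ (∀ x ∈ B, s x ∈ B) ∧ s x₀ ≠ q ∧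
      (∀ x ∈ B, ∀ y ∈ B, (f * s).SameCycle x y) ∧
      ∀ x y, f.SameCycle x y → (f * s).SameCycle x y := by
  obtain ⟨r, hr, hrB⟩ := exists_firstReturn f B
  -- `c` is the prescribed return map of `f * s` to `B`. If `c` and `c⁻¹` both sent `x₀` to `r q`,
  -- then `c ^ 2` would fix `x₀`, forcing `B.card ∣ 2`.
  obtain ⟨c, hc, hcB, hcq⟩ : ∃ c : Perm X, c.IsCycleOn B ∧ (∀ x ∉ B, c x = x) ∧ c x₀ ≠ r q := by
    obtain ⟨c, hc, hcs⟩ := B.exists_cycleOn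
    have hfix : ∀ x ∉ B, c x = x := fun x hx => by
      by_contra h
      exact hx (hcs (Perm.mem_support.2 h))
    by_cases h : c x₀ = r q
    · refine ⟨c⁻¹, hc.inv, fun x hx => Perm.inv_eq_iff_eq.2 (hfix x hx).symm, fun h' => ?_⟩
      have h2 : (c ^ 2) x₀ = x₀ := by
        rw [pow_two, Perm.mul_apply, h, ← h']
        simp
      have := Nat.le_of_dvd two_pos ((hc.pow_apply_eq hx₀).1 h2)
      omega
    · exact ⟨c, hc, hfix, h⟩
  have hmem : ∀ {g : Perm X}, (∀ x ∉ B, g x = x) → ∀ x ∈ B, g x ∈ B := by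
    intro g hg x hx
    by_contra h
    exact h ((g.injective (hg _ h)).symm ▸ hx)
  set s : Perm X := r⁻¹ * c with hs
  have hsB : ∀ x ∉ B, s x = x := fun x hx => by
    rw [hs, Perm.mul_apply, hcB x hx]
    exact Perm.inv_eq_iff_eq.2 (hr x hx).symm
  have hc' : ∀ x, r (s x) = c x := fun x => by simp [hs]
  have hstep : ∀ x ∈ B, (f * s).SameCycle x (c x) := by
    intro x hx
    obtain ⟨-, m, hm, hj⟩ := hrB _ (hmem hsB x hx)
    -- Until the orbit returns to `B`, `s` acts trivially on it, so `f * s` follows `f` from `s x`.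
    have hpow : ∀ j ≤ m, ((f * s) ^ (j + 1)) x = (f ^ (j + 1)) (s x) := by
      intro j hjm
      induction j with
      | zero => simp
      | succ j ih =>
        rw [pow_succ', Perm.mul_apply, ih (by omega), Perm.mul_apply, hsB _ (hj j (by omega)),
          pow_succ' f (j + 1), Perm.mul_apply f]
    exact ⟨(m + 1 : ℕ), by rw [zpow_natCast, hpow m le_rfl, ← hm, hc']⟩
  have hpowc : ∀ x ∈ B, ∀ j : ℕ, (f * s).SameCycle x ((c ^ j) x) ∧ (c ^ j) x ∈ B := by
    intro x hx j
    induction j with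
    | zero => exact ⟨SameCycle.refl _ _, hx⟩
    | succ j ih =>
      rw [pow_succ', Perm.mul_apply]
      exact ⟨ih.1.trans (hstep _ ih.2), hmem hcB _ ih.2⟩
  have hall : ∀ x ∈ B, ∀ y ∈ B, (f * s).SameCycle x y := by
    intro x hx y hy
    obtain ⟨j, -, rfl⟩ := hc.exists_pow_eq hx hy
    exact (hpowc x hx j).1
  have hone : ∀ x, (f * s).SameCycle x (f x) := by
    intro x
    by_cases hx : x ∈ B
    · have hx' : s⁻¹ x ∈ B := hmem (fun y hy => Perm.inv_eq_iff_eq.2 (hsB y hy).symm) x hx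
      refine (hall x hx _ hx').trans ⟨1, by simp⟩
    · exact ⟨1, by simp [hsB x hx]⟩
  refine ⟨s, hsB, hmem hsB, fun h => hcq (by rw [← hc', h]), hall, ?_⟩
  rintro x y hxy
  obtain ⟨j, -, rfl⟩ := hxy.exists_pow_eq'
  clear hxy
  induction j with
  | zero => exact SameCycle.refl _ _
  | succ j ih =>
    rw [pow_succ', Perm.mul_apply]
    exact ih.trans (hone _)

theorem List.length_splitBy_of_isChain_not {α : Type*} {r : α → α → Bool} {l : List α}
    (h : l.IsChain fun a b => r a b = false) : (l.splitBy r).length = l.length := by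
  induction l with
  | nil => rfl
  | cons a l ih =>
    cases l with
    | nil => rfl
    | cons b l =>
      rw [List.isChain_cons_cons] at h
      rw [← List.singleton_append, List.splitBy_append_cons l (by simpa using h.1),
        List.length_append, ih h.2]
      exact Nat.add_comm 1 _

/-! ### Cyclic block shuffles -/

/-- A permutation of the positions of a word of length `k * n` that sends the `b`-th block of `k`
consecutive positions onto the residue class of `b` modulo `n`. These are the last-to-first
mappings of the concatenations of `n` alphabet-permutations. -/
def IsBlockShuffle {k n : ℕ} (p : Equiv.Perm (Fin (k * n))) : Prop :=
  ∀ x, (p x : ℕ) % n = (x : ℕ) / k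

theorem exists_isBlockShuffle (k n : ℕ) : ∃ p : Equiv.Perm (Fin (k * n)), IsBlockShuffle p := by
  refine ⟨(finCongr (mul_comm k n)).trans (finProdFinEquiv.symm.trans
    ((Equiv.prodComm _ _).trans finProdFinEquiv)), fun x => ?_⟩
  have : (x : ℕ) / k < n := Nat.div_lt_of_lt_mul x.2
  simp [finProdFinEquiv, Nat.mod_eq_of_lt this]

theorem IsBlockShuffle.eq_of_div_eq {k n : ℕ} {p : Equiv.Perm (Fin (k * n))}
    (hp : IsBlockShuffle p) {x y : Fin (k * n)} (h : (x : ℕ) / k = y / k)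
    (h' : (p x : ℕ) / n = p y / n) : x = y := by
  apply p.injective
  apply Fin.ext
  rw [← Nat.div_add_mod (p x : ℕ) n, ← Nat.div_add_mod (p y : ℕ) n, h', hp, hp, h]

-- Induction on the number `b` of treated blocks: permuting the inputs in block `b` leaves the
-- earlier letters unchanged and preserves cycle relations.
open Equiv Equiv.Perm in
theorem exists_isBlockShuffle_prefix {k n : ℕ} (hk : 3 ≤ k) (b : ℕ) (hb : b ≤ n) :
    ∃ p : Perm (Fin (k * n)), IsBlockShuffle p ∧
      (∀ x y : Fin (k * n), (x : ℕ) / k = y / k → (x : ℕ) / k < b → p.SameCycle x y) ∧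
      ∀ x y : Fin (k * n), (y : ℕ) = x + 1 → (y : ℕ) / k < b → (p x : ℕ) / n ≠ p y / n := by
  have hk0 : 0 < k := by omega
  induction b with
  | zero =>
    obtain ⟨p, hp⟩ := exists_isBlockShuffle k n
    exact ⟨p, hp, by simp, by simp⟩
  | succ b ih =>
    obtain ⟨p, hp, hcyc, hne⟩ := ih (by omega)
    have hlt : ∀ i < k, k * b + i < k * n := fun i hi => by
      calc k * b + i < k * (b + 1) := by rw [mul_add]; omega
        _ ≤ k * n := Nat.mul_le_mul_left k hb
    have hdiv : ∀ i < k, (k * b + i) / k = b := fun i hi => by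
      rw [Nat.mul_add_div hk0, Nat.div_eq_of_lt hi, add_zero]
    let x₀ : Fin (k * n) := ⟨k * b, by simpa using hlt 0 hk0⟩
    have hx₀ : (x₀ : ℕ) / k = b := by simpa using hdiv 0 hk0
    let B : Finset (Fin (k * n)) := Finset.univ.filter fun x => (x : ℕ) / k = b
    have hmemB : ∀ x, x ∈ B ↔ (x : ℕ) / k = b := fun x => by simp [B]
    have hcard : 3 ≤ B.card := by
      refine Finset.le_card_of_inj_on_range
        (fun i => if h : i < k then ⟨k * b + i, hlt i h⟩ else x₀) (fun i hi => ?_) ?_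
      · have hi' : i < k := by omega
        simp [hmemB, hi', hdiv i hi']
      · intro i hi j hj hij
        have hi' : i < k := by omega
        have hj' : j < k := by omega
        simpa [hi', hj'] using hij
    -- `q` is the only point of block `b` whose letter repeats the one just before the block. If
    -- there is none, `x₀` is a dummy value.
    obtain ⟨q, hq⟩ : ∃ q, ∀ x : Fin (k * n), (x₀ : ℕ) = x + 1 →
        ∀ z : Fin (k * n), (z : ℕ) / k = b → (p x : ℕ) / n = p z / n → z = q := by
      by_cases h : ∃ x : Fin (k * n), (x₀ : ℕ) = x + 1 ∧
        ∃ q : Fin (k * n), (q : ℕ) / k = b ∧ (p x : ℕ) / n = p q / n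
      · obtain ⟨x, hx, q, hqb, hxq⟩ := h
        refine ⟨q, fun x' hx' z hz hxz => hp.eq_of_div_eq (hz.trans hqb.symm) ?_⟩
        obtain rfl : x = x' := Fin.ext (by omega)
        rw [← hxz, hxq]
      · exact ⟨x₀, fun x hx z hz hxz => (h ⟨x, hx, z, hz, hxz⟩).elim⟩
    obtain ⟨s, hs, hsB, hsq, hall, hmono⟩ := exists_merge p B hcard x₀ q ((hmemB _).2 hx₀)
    have hsdiv : ∀ x, (s x : ℕ) / k = (x : ℕ) / k := fun x => by
      by_cases hx : x ∈ B
      · rw [(hmemB _).1 (hsB x hx), (hmemB _).1 hx]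
      · rw [hs x hx]
    have hps : IsBlockShuffle (p * s) := fun x => (hp (s x)).trans (hsdiv x)
    have hfix : ∀ x : Fin (k * n), (x : ℕ) / k < b → s x = x := fun x hx =>
      hs x fun h => by have := (hmemB x).1 h; omega
    refine ⟨p * s, hps, fun x y hxy hx => ?_, fun x y hxy hy h => ?_⟩
    · rcases Nat.lt_succ_iff_lt_or_eq.1 hx with hx | hx
      · exact hmono _ _ (hcyc x y hxy hx)
      · exact hall _ ((hmemB _).2 hx) _ ((hmemB _).2 (hxy ▸ hx))
    · by_cases hd : (x : ℕ) / k = y / k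
      · have := hps.eq_of_div_eq hd h
        subst this
        omega
      · have hle : (x : ℕ) / k ≤ y / k := Nat.div_le_div_right (by omega)
        have hx : s x = x := hfix x (by omega)
        rw [Perm.mul_apply, Perm.mul_apply, hx] at h
        by_cases hyb : (y : ℕ) / k < b
        · rw [hfix y hyb] at h
          exact hne x y hxy hyb h
        · have hyb : (y : ℕ) / k = b := by omega
          have hy0 : y = x₀ := Fin.ext <| by
            have h1 : k * b ≤ y := hyb ▸ Nat.mul_div_le _ _
            have h2 : (x : ℕ) < k * b := by
              refine lt_of_lt_of_eq ?_ (mul_comm b k)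
              exact (Nat.div_lt_iff_lt_mul hk0).1 (by omega)
            change (y : ℕ) = k * b
            omega
          subst hy0
          exact hsq (hq x hxy _ (hsdiv x₀ ▸ hx₀) h)

open Equiv Equiv.Perm in
/-- There is a cyclic block shuffle whose word has no two consecutive equal letters. -/
theorem exists_isBlockShuffle_isCycleOn {k n : ℕ} (hk : 3 ≤ k) (hn : 0 < n) :
    ∃ p : Perm (Fin (k * n)), IsBlockShuffle p ∧ p.IsCycleOn Set.univ ∧
      ∀ x y : Fin (k * n), (y : ℕ) = x + 1 → (p x : ℕ) / n ≠ p y / n := by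
  obtain ⟨p, hp, hcyc, hne⟩ := exists_isBlockShuffle_prefix hk n le_rfl
  have hlt : ∀ x : Fin (k * n), (x : ℕ) / k < n := fun x => Nat.div_lt_of_lt_mul x.2
  refine ⟨p, hp, ⟨p.bijective.bijOn_univ, ?_⟩, fun x y hxy => hne x y hxy (hlt y)⟩
  have h0 : 0 < k * n := by positivity
  have key : ∀ (m : ℕ) (hm : m < k * n), p.SameCycle ⟨m, hm⟩ ⟨0, h0⟩ := by
    intro m
    induction m using Nat.strong_induction_on with
    | _ m ih =>
      intro hm
      rcases Nat.eq_zero_or_pos m with rfl | hpos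
      · exact SameCycle.refl _ _
      · have hd : m / k < m := Nat.div_lt_self hpos (by omega)
        -- `p⁻¹ (m / k)` lies in the same block as `m`, and `p` sends it to `m / k`.
        refine SameCycle.trans ?_ (ih _ hd (by omega))
        set y : Fin (k * n) := ⟨m / k, by omega⟩ with hy
        refine (hcyc ⟨m, hm⟩ (p⁻¹ y) ?_ (hlt _)).trans ⟨1, by simp⟩
        rw [← hp (p⁻¹ y)]
        simp [hy, Nat.mod_eq_of_lt (hlt ⟨m, hm⟩)]
  exact fun x _ y _ => (key x x.2).trans (key y y.2).symm

/-! ### From a block shuffle to a necklace and its BWT -/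

section Rows

open Equiv

variable {k n : ℕ}

/-- The word of length `m` spelled by following the inverse of `p` from the position `x`, where the
letter at a position `y` is `y / n`. -/
def shuffleRow (p : Perm (Fin (k * n))) (m : ℕ) (x : Fin (k * n)) : List (Fin k) :=
  (List.range m).map fun j => ((p⁻¹ ^ j) x).divNat

@[simp]
theorem length_shuffleRow (p : Perm (Fin (k * n))) (m : ℕ) (x : Fin (k * n)) :
    (shuffleRow p m x).length = m := by simp [shuffleRow]

theorem shuffleRow_succ (p : Perm (Fin (k * n))) (m : ℕ) (x : Fin (k * n)) :
    shuffleRow p (m + 1) x = x.divNat :: shuffleRow p m (p⁻¹ x) := by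
  simp only [shuffleRow, List.range_succ_eq_map, List.map_cons, List.map_map, pow_zero]
  rfl

theorem IsBlockShuffle.inv_div {p : Perm (Fin (k * n))} (hp : IsBlockShuffle p)
    (x : Fin (k * n)) : (p⁻¹ x : ℕ) / k = x % n := by
  rw [← hp]
  simp

/-- If the first letters agree, the residues modulo `n` are ordered like `x` and `y`. They are the
block indices of `p⁻¹ x` and `p⁻¹ y`, so the order persists. -/
theorem IsBlockShuffle.shuffleRow_mono {p : Perm (Fin (k * n))} (hp : IsBlockShuffle p) (m : ℕ)
    {x y : Fin (k * n)} (h : x ≤ y) : shuffleRow p m x ≤ shuffleRow p m y := by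
  induction m generalizing x y with
  | zero => exact le_rfl
  | succ m ih =>
    rcases h.eq_or_lt with rfl | hlt
    · exact le_rfl
    rw [shuffleRow_succ, shuffleRow_succ]
    have hle : (x : ℕ) / n ≤ y / n := Nat.div_le_div_right hlt.le
    rcases hle.eq_or_lt with heq | hdlt
    · rw [show x.divNat = y.divNat from Fin.ext heq]
      refine List.cons_le_cons _ (ih ?_)
      have hmod : (x : ℕ) % n < y % n := by
        have h1 := Nat.div_add_mod (x : ℕ) n
        have h2 := Nat.div_add_mod (y : ℕ) n
        have h3 : (x : ℕ) < y := hlt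
        rw [heq] at h1
        omega
      rw [← hp.inv_div, ← hp.inv_div] at hmod
      exact (Nat.lt_of_div_lt_div hmod).le
    · exact le_of_lt (List.Lex.rel hdlt)

/-- The necklace whose last-to-first mapping is `p`. -/
def shuffleNecklace (p : Perm (Fin (k * n))) (x : Fin (k * n)) : Necklace k :=
  (shuffleRow p (k * n) x : Cycle (Fin k))

theorem length_shuffleNecklace (p : Perm (Fin (k * n))) (x : Fin (k * n)) :
    (shuffleNecklace p x).length = k * n := by simp [shuffleNecklace]

theorem shuffleRow_rotate {p : Perm (Fin (k * n))} (hp : p.IsCycleOn Set.univ)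
    (x : Fin (k * n)) (i : ℕ) :
    (shuffleRow p (k * n) x).rotate i = shuffleRow p (k * n) ((p⁻¹ ^ i) x) := by
  have hp' : p⁻¹.IsCycleOn ((Finset.univ : Finset (Fin (k * n))) : Set (Fin (k * n))) := by
    simpa using hp.inv
  refine List.ext_getElem (by simp) fun j h1 h2 => ?_
  simp only [shuffleRow, List.getElem_rotate, List.getElem_map, List.getElem_range,
    List.length_map, List.length_range]
  rw [← Perm.mul_apply, ← pow_add]
  congr 1
  rw [hp'.pow_apply_eq_pow_apply (Finset.mem_univ x)]
  simpa using Nat.mod_modEq _ _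

theorem lists_shuffleNecklace {p : Perm (Fin (k * n))} (hp : p.IsCycleOn Set.univ)
    (x : Fin (k * n)) :
    (shuffleNecklace p x).lists = ((List.finRange (k * n)).map (shuffleRow p (k * n)) :) := by
  have hp' : p⁻¹.IsCycleOn ((Finset.univ : Finset (Fin (k * n))) : Set (Fin (k * n))) := by
    simpa using hp.inv
  have hne : shuffleRow p (k * n) x ≠ [] := by
    rw [← List.length_pos_iff, length_shuffleRow]
    exact x.pos
  have h1 : (shuffleRow p (k * n) x).cyclicPermutations =
      ((List.range (k * n)).map fun i => (p⁻¹ ^ i) x).map (shuffleRow p (k * n)) := by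
    refine List.ext_getElem (by simp [List.length_cyclicPermutations_of_ne_nil _ hne])
      fun j _ _ => ?_
    rw [List.getElem_cyclicPermutations, shuffleRow_rotate hp]
    simp
  rw [shuffleNecklace, Cycle.lists_coe, h1, Multiset.coe_eq_coe]
  refine List.Perm.map _ ((List.perm_ext_iff_of_nodup ?_ (List.nodup_finRange _)).2 fun y => ?_)
  · refine List.Nodup.map_on (fun i hi j hj hij => ?_) List.nodup_range
    rw [hp'.pow_apply_eq_pow_apply (Finset.mem_univ x), Finset.card_univ, Fintype.card_fin] at hij
    exact hij.eq_of_lt_of_lt (List.mem_range.1 hi) (List.mem_range.1 hj)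
  · obtain ⟨i, hi, hy⟩ := hp'.exists_pow_eq (Finset.mem_univ x) (Finset.mem_univ y)
    simp only [List.mem_finRange, iff_true, List.mem_map, List.mem_range]
    exact ⟨i, by simpa using hi, hy⟩

theorem bwtMatrix_shuffleNecklace {p : Perm (Fin (k * n))} (hp : IsBlockShuffle p)
    (hc : p.IsCycleOn Set.univ) (x : Fin (k * n)) :
    (shuffleNecklace p x).bwtMatrix = (List.finRange (k * n)).map (shuffleRow p (k * n)) := by
  rw [Necklace.bwtMatrix, lists_shuffleNecklace hc, Multiset.coe_sort]
  refine List.mergeSort_eq_self _ ?_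
  rw [List.pairwise_map]
  exact (List.pairwise_le_finRange _).imp fun h => hp.shuffleRow_mono _ h

theorem bwt_shuffleNecklace {p : Perm (Fin (k * n))} (hp : IsBlockShuffle p)
    (hc : p.IsCycleOn Set.univ) (x : Fin (k * n)) :
    (shuffleNecklace p x).bwt = List.ofFn fun y => (p y).divNat := by
  have hp' : p⁻¹.IsCycleOn ((Finset.univ : Finset (Fin (k * n))) : Set (Fin (k * n))) := by
    simpa using hc.inv
  obtain ⟨N, hN⟩ := Nat.exists_eq_add_of_lt x.pos
  rw [zero_add] at hN
  have hlast : ∀ y, (shuffleRow p (k * n) y).getLast? = some (p y).divNat := fun y => by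
    -- The cycle has length `N + 1`, so `N` steps back equal one step forward.
    have h : (p⁻¹ ^ N) y = p y := by
      have h := hp'.pow_card_apply (Finset.mem_univ (p y))
      have hcard : (Finset.univ : Finset (Fin (k * n))).card = N + 1 := by simpa using hN
      rw [hcard, pow_succ, Perm.mul_apply] at h
      simpa using h
    have hrange : List.range (k * n) = List.range N ++ [N] :=
      (congrArg List.range hN).trans List.range_succ
    rw [shuffleRow, hrange, List.map_append, List.map_singleton, h, List.getLast?_concat]
  rw [Necklace.bwt, bwtMatrix_shuffleNecklace hp hc, List.filterMap_map, List.ofFn_eq_map,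
    ← List.filterMap_eq_map]
  congr 1
  exact funext hlast

theorem isGeneralizedDeBruijn_shuffleNecklace {p : Perm (Fin (k * n))} (hp : IsBlockShuffle p)
    (hc : p.IsCycleOn Set.univ) (x : Fin (k * n)) :
    Necklace.IsGeneralizedDeBruijn n (shuffleNecklace p x) := by
  have hn : 0 < n := Nat.pos_of_mul_pos_left x.pos
  have hk : 0 < k := Nat.pos_of_mul_pos_right x.pos
  refine ⟨length_shuffleNecklace p x, _, ?_, ?_,
    (bwt_shuffleNecklace hp hc x).trans (List.ofFn_mul' _)⟩
  · rw [← List.length_pos_iff]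
    simpa using hn
  · intro w hw
    rw [List.mem_ofFn'] at hw
    obtain ⟨b, rfl⟩ := hw
    intro a
    set g : Fin k → Fin k := _
    change (List.ofFn g).count a = 1
    have hg : Function.Injective g := by
      intro i j hij
      have h := hp.eq_of_div_eq (x := ⟨k * b + i, _⟩) (y := ⟨k * b + j, _⟩)
        (by simp [Nat.mul_add_div hk, Nat.div_eq_of_lt]) (congrArg Fin.val hij)
      apply Fin.ext
      simpa using h
    refine List.count_eq_one_of_mem (List.nodup_ofFn.2 hg) ?_
    rw [List.mem_ofFn']
    exact Finite.surjective_of_injective hg a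

theorem completelyUnclustered_shuffleNecklace {p : Perm (Fin (k * n))} (hp : IsBlockShuffle p)
    (hc : p.IsCycleOn Set.univ)
    (hne : ∀ x y : Fin (k * n), (y : ℕ) = x + 1 → (p x : ℕ) / n ≠ p y / n) (x : Fin (k * n)) :
    Necklace.CompletelyUnclustered (shuffleNecklace p x) := by
  rw [Necklace.CompletelyUnclustered, Necklace.rho, wordRuns, bwt_shuffleNecklace hp hc,
    length_shuffleNecklace, List.length_splitBy_of_isChain_not, List.length_ofFn]
  rw [List.isChain_iff_getElem]
  intro i hi
  simp only [List.getElem_ofFn, beq_eq_false_iff_ne]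
  exact fun h => hne _ _ rfl (congrArg Fin.val h)

end Rows

/-! ### The case `n = k ^ d`: standard de Bruijn words -/

section DeBruijn

open Equiv

/-- The number whose base `k` digits, the most significant first, are the letters of a word. -/
def wordValue {k : ℕ} : List (Fin k) → ℕ
  | [] => 0
  | a :: v => a * k ^ v.length + wordValue v

theorem wordValue_lt {k : ℕ} (v : List (Fin k)) : wordValue v < k ^ v.length := by
  induction v with
  | nil => simp [wordValue]
  | cons a v ih =>
    calc wordValue (a :: v) < (a + 1) * k ^ v.length := by rw [wordValue, add_one_mul]; omega
      _ ≤ k * k ^ v.length := Nat.mul_le_mul_right _ a.2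
      _ = k ^ (a :: v).length := (pow_succ' _ _).symm

/-- In base `k` with `d + 1` digits, `p⁻¹` drops the leading digit, shifts the others left and
appends some digit. Hence the row at `x` begins with the digits of `x`; `e` counts those that `v`
leaves free. -/
theorem IsBlockShuffle.isPrefix_shuffleRow_iff {k d : ℕ} {p : Perm (Fin (k * k ^ d))}
    (hp : IsBlockShuffle p) (v : List (Fin k)) (e m : ℕ) (he : v.length + e = d + 1)
    (hm : v.length ≤ m) (x : Fin (k * k ^ d)) :
    v <+: shuffleRow p m x ↔ (x : ℕ) / k ^ e = wordValue v := by
  have hk : 0 < k := Nat.pos_of_mul_pos_right x.pos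
  induction v generalizing e m x with
  | nil =>
    have hx : (x : ℕ) / k ^ e = 0 := Nat.div_eq_of_lt <| by
      rw [List.length_nil, zero_add] at he
      rw [he, pow_succ']
      exact x.2
    simp [wordValue, hx]
  | cons a v ih =>
    obtain ⟨m, rfl⟩ := Nat.exists_eq_add_of_lt (Nat.lt_of_lt_of_le (Nat.succ_pos _) hm)
    rw [zero_add] at hm ⊢
    rw [List.length_cons] at he hm
    have ih' : v <+: shuffleRow p m (p⁻¹ x) ↔
        (p⁻¹ x : ℕ) / k ^ (e + 1) = wordValue v :=
      ih (e + 1) m (by omega) (by omega) (p⁻¹ x)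
    rw [shuffleRow_succ, List.cons_prefix_cons, ih', pow_succ',
      ← Nat.div_div_eq_div_mul, hp.inv_div, Fin.ext_iff, wordValue]
    obtain rfl : d = e + v.length := by omega
    have hpos : 0 < k ^ e := by positivity
    have hdiv : ∀ y : ℕ, y / k ^ e =
        y / k ^ (e + v.length) * k ^ v.length + y % k ^ (e + v.length) / k ^ e := fun y => by
      conv_lhs => rw [← Nat.div_add_mod y (k ^ (e + v.length))]
      rw [pow_add, mul_assoc, Nat.mul_add_div hpos, mul_comm (k ^ v.length)]
    have hlt : (x : ℕ) % k ^ (e + v.length) / k ^ e < k ^ v.length :=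
      Nat.div_lt_of_lt_mul (by rw [← pow_add]; exact Nat.mod_lt _ (by positivity))
    have hv := wordValue_lt v
    rw [hdiv x, Fin.coe_divNat]
    constructor
    · rintro ⟨h1, h2⟩
      rw [h1, h2]
    · intro h
      have h1 := congrArg (· / k ^ v.length) h
      have h2 := congrArg (· % k ^ v.length) h
      have hpos' : 0 < k ^ v.length := by positivity
      simp only [mul_comm _ (k ^ v.length), Nat.mul_add_div hpos', Nat.div_eq_of_lt hlt,
        Nat.div_eq_of_lt hv, add_zero] at h1
      simp only [mul_comm _ (k ^ v.length), Nat.mul_add_mod, Nat.mod_eq_of_lt hlt,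
        Nat.mod_eq_of_lt hv] at h2
      exact ⟨h1.symm, h2⟩

theorem isDeBruijn_shuffleNecklace {k d : ℕ} (hk : 2 ≤ k) {p : Perm (Fin (k * k ^ d))}
    (hp : IsBlockShuffle p) (hc : p.IsCycleOn Set.univ) (x : Fin (k * k ^ d)) :
    Necklace.IsDeBruijn (d + 1) (shuffleNecklace p x) := by
  intro v hv
  have hlt : wordValue v < k * k ^ d := by
    rw [← pow_succ', ← hv]
    exact wordValue_lt v
  have hm : v.length ≤ k * k ^ d := by
    rw [hv, ← pow_succ']
    exact (Nat.lt_pow_self hk).le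
  rw [Necklace.circularOccurrences, lists_shuffleNecklace hc, Multiset.coe_countP, List.countP_map]
  rw [← List.count_eq_one_of_mem (List.nodup_finRange _) (List.mem_finRange ⟨wordValue v, hlt⟩),
    List.count]
  refine List.countP_congr fun y _ => ?_
  have := hp.isPrefix_shuffleRow_iff v 0 _ hv hm y
  simp only [pow_zero, Nat.div_one] at this
  simp [this, Fin.ext_iff]

end DeBruijn

theorem mainTheorem2 (n k : ℕ) (hn : 0 < n) (hk : 3 ≤ k) :
    (∃ u : Necklace k,
      Necklace.IsGeneralizedDeBruijn n u ∧ Necklace.CompletelyUnclustered u) ∧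
    (∃ u : Necklace k,
      Necklace.IsDeBruijn n u ∧ Cycle.length u = k ^ n ∧ Necklace.CompletelyUnclustered u) := by
  constructor
  · obtain ⟨p, hp, hc, hne⟩ := exists_isBlockShuffle_isCycleOn hk hn
    let x : Fin (k * n) := ⟨0, by positivity⟩
    exact ⟨shuffleNecklace p x, isGeneralizedDeBruijn_shuffleNecklace hp hc x,
      completelyUnclustered_shuffleNecklace hp hc hne x⟩
  · obtain ⟨d, rfl⟩ := Nat.exists_eq_succ_of_ne_zero hn.ne'
    obtain ⟨p, hp, hc, hne⟩ := exists_isBlockShuffle_isCycleOn (n := k ^ d) hk (by positivity)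
    let x : Fin (k * k ^ d) := ⟨0, by positivity⟩
    exact ⟨shuffleNecklace p x, isDeBruijn_shuffleNecklace (by omega) hp hc x,
      (length_shuffleNecklace p x).trans (pow_succ' k d).symm,
      completelyUnclustered_shuffleNecklace hp hc hne x⟩
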